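/- Let $M_{0,6}$ be the moduli space of six distinct ordered points $p_1,\dots,p_6$ on $\mathbb{P}^1_{\mathbb{C}}$ modulo $\mathrm{PGL}(2,\mathbb{C})$, and let $\overline{M}_{0,6}$ be its Deligne--Mumford--Knudsen compactification. Let $\phi:\overline{M}_{0,6}\hookrightarrow\mathbb{P}^1\times\mathbb{P}^2\times\mathbb{P}^3$ be the closed embedding whose component in $\mathbb{P}^i$ $(i=1,2,3)$ is given on the dense open subset $M_{0,6}$ by $$[p_1,\dots,p_6]\mapsto\left[\frac{p_1-p_2}{p_{i+3}-p_2}:\cdots:\frac{p_1-p_{i+2}}{p_{i+3}-p_{i+2}}\right];$$ its image is the Zariski closure of $\phi(M_{0,6})$, with its reduced structure. Let $S=\mathbb{C}[a_0,a_1,b_0,b_1,b_2,c_0,c_1,c_2,c_3]$ be the Cox ring of $\mathbb{P}^1\times\mathbb{P}^2\times\mathbb{P}^3$, graded by $\mathbb{N}^3$ with $\deg a_i=(1,0,0)$, $\deg b_i=(0,1,0)$, $\deg c_i=(0,0,1)$, and let $B=\langle a_0,a_1\rangle\cap\langle b_0,b_1,b_2\rangle\cap\langle c_0,c_1,c_2,c_3\rangle$.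 Let $I_6\subset S$ be the unique $B$-saturated multihomogeneous ideal that defines $\phi(\overline{M}_{0,6})$ scheme-theoretically, and let $J_6\subset S$ be the ideal generated by $$\begin{aligned} f_1&=b_1c_1c_2-b_2c_1c_2+b_2c_1c_3-b_1c_2c_3, & f_2&=b_0c_0c_2-b_2c_0c_2+b_2c_0c_3-b_0c_2c_3,\\ f_3&=b_0c_0c_1-b_1c_0c_1+b_1c_0c_3-b_0c_1c_3, & f_4&=a_0c_0c_1-a_1c_0c_1+a_1c_0c_2-a_0c_1c_2,\\ f_5&=a_0b_0b_1-a_1b_0b_1+a_1b_0b_2-a_0b_1b_2. \end{aligned}$$ For an ideal $K$ of $S$ let $K_{(i,j,k)}$ be the complex vector space of polynomials of multidegree $(i,j,k)$ in $K$. **Proposition.** The ideal $I_6$ exists and is unique. The ideal $J_6$ is properly contained in $I_6$; more precisely, $J_6\subset I_6$ and $$\dim_{\mathbb{C}} (J_6)_{(1,1,2)}=9<10=\dim_{\mathbb{C}} (I_6)_{(1,1,2)}.$$ However, $(J_6)_{(2,2,2)}=(I_6)_{(2,2,2)}$, and $\dim_{\mathbb{C}} (J_6)_{(2,2,2)}=\dim_{\mathbb{C}}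 (I_6)_{(2,2,2)}=55$. -/

import Mathlib

open scoped LinearAlgebra.Projectivization

noncomputable section

namespace MBar06

/-! ### The Cox ring of `ℙ¹ × ℙ² × ℙ³` -/

/-- The homogeneous coordinates of `ℙ¹ × ℙ² × ℙ³`: the pair `⟨i, j⟩` is the `j`-th coordinate
(`0 ≤ j ≤ i + 1`) on the factor `ℙ^(i+1)`, `i = 0, 1, 2`. -/
abbrev Var : Type := Σ i : Fin 3, Fin (i.val + 2)

/-- The Cox ring `ℂ[a₀, a₁, b₀, b₁, b₂, c₀, c₁, c₂, c₃]` of `ℙ¹ × ℙ² × ℙ³`. -/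
abbrev CoxRing : Type := MvPolynomial Var ℂ

/-- The multidegree of a variable: a coordinate of the `i`-th factor has the `i`-th unit vector. -/
def multidegree (v : Var) : Fin 3 → ℕ := Pi.single v.1 1

/-- The coordinates `a₀, a₁` on `ℙ¹`. -/
def a (j : Fin 2) : CoxRing := MvPolynomial.X ⟨0, j⟩

/-- The coordinates `b₀, b₁, b₂` on `ℙ²`. -/
def b (j : Fin 3) : CoxRing := MvPolynomial.X ⟨1, j⟩

/-- The coordinates `c₀, c₁, c₂, c₃` on `ℙ³`. -/
def c (j : Fin 4) : CoxRing := MvPolynomial.X ⟨2, j⟩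

/-- The homogeneous part of multidegree `d` of an ideal, as a complex vector space. -/
def gradedPart (I : Ideal CoxRing) (d : Fin 3 → ℕ) : Submodule ℂ CoxRing :=
  I.restrictScalars ℂ ⊓ MvPolynomial.weightedHomogeneousSubmodule ℂ multidegree d

/-- An ideal is multihomogeneous if it contains the multihomogeneous components of its elements. -/
def IsMultihomogeneous (I : Ideal CoxRing) : Prop :=
  ∀ f ∈ I, ∀ d : Fin 3 → ℕ, MvPolynomial.weightedHomogeneousComponent multidegree d f ∈ I

/-- The irrelevant ideal `B = ⟨a₀, a₁⟩ ∩ ⟨b₀, b₁, b₂⟩ ∩ ⟨c₀, c₁, c₂, c₃⟩`. -/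
def irrelevantIdeal : Ideal CoxRing :=
  Ideal.span (Set.range a) ⊓ Ideal.span (Set.range b) ⊓ Ideal.span (Set.range c)

/-- `I` is `B`-saturated: `(I : B ^ N) ⊆ I` for all `N`. -/
def IsBSaturated (I : Ideal CoxRing) : Prop :=
  ∀ (N : ℕ) (f : CoxRing), (∀ g ∈ irrelevantIdeal ^ N, g * f ∈ I) → f ∈ I

/-! ### The ideal `J₆` -/

/-- The ideal `J₆`, generated by the five polynomials `f₁, …, f₅`. -/
def J6 : Ideal CoxRing :=
  Ideal.span
    {b 1 * c 1 * c 2 - b 2 * c 1 * c 2 + b 2 * c 1 * c 3 - b 1 * c 2 * c 3,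
     b 0 * c 0 * c 2 - b 2 * c 0 * c 2 + b 2 * c 0 * c 3 - b 0 * c 2 * c 3,
     b 0 * c 0 * c 1 - b 1 * c 0 * c 1 + b 1 * c 0 * c 3 - b 0 * c 1 * c 3,
     a 0 * c 0 * c 1 - a 1 * c 0 * c 1 + a 1 * c 0 * c 2 - a 0 * c 1 * c 2,
     a 0 * b 0 * b 1 - a 1 * b 0 * b 1 + a 1 * b 0 * b 2 - a 0 * b 1 * b 2}

/-! ### The moduli space `M_{0,6}` and the map `φ` -/

/-- Ordered 6-tuples of distinct points of `ℙ¹`. The points `p₁, …, p₆` have indices `0, …, 5`. -/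
abbrev Config : Type := {p : Fin 6 → ℙ ℂ (Fin 2 → ℂ) // Function.Injective p}

/-- Two 6-tuples are equivalent if a projective transformation of `ℙ¹`, i.e. the map induced by a
linear automorphism of `ℂ²`, takes one to the other. -/
def configSetoid : Setoid Config where
  r p q := ∃ g : (Fin 2 → ℂ) ≃ₗ[ℂ] (Fin 2 → ℂ), ∀ k, q.1 k = g • p.1 k
  iseqv :=
    { refl := fun _ => ⟨1, fun _ => (one_smul _ _).symm⟩
      symm := by
        rintro p q ⟨g, hg⟩
        exact ⟨g⁻¹, fun k => by rw [hg k, inv_smul_smul]⟩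
      trans := by
        rintro p q r ⟨g, hg⟩ ⟨h, hh⟩
        exact ⟨h * g, fun k => by rw [hh k, hg k, mul_smul]⟩ }

/-- The moduli space `M_{0,6}` of six distinct ordered points on `ℙ¹`. -/
def M06 : Type := Quotient configSetoid

/-- The product `ℙ¹ × ℙ² × ℙ³`. -/
abbrev ProdP : Type := ∀ i : Fin 3, ℙ ℂ (Fin (i.val + 2) → ℂ)

/-- The bracket `v ∧ w`. For `v = (x, 1)` and `w = (y, 1)` it is the difference `x - y`. -/
def bracket (v w : Fin 2 → ℂ) : ℂ := v 0 * w 1 - v 1 * w 0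

/-- The coordinates of `φ` on six vectors of `ℂ²`. For `v k = (p k, 1)`, and with the points
numbered from 1, the `j`-th coordinate on the factor `ℙ^i` is
`(p₁ - p_{j+2}) / (p_{i+3} - p_{j+2})`. -/
def phiCoord (v : Fin 6 → Fin 2 → ℂ) (i : Fin 3) (j : Fin (i.val + 2)) : ℂ :=
  bracket (v 0) (v ⟨j.val + 1, by omega⟩) /
    bracket (v ⟨i.val + 3, by omega⟩) (v ⟨j.val + 1, by omega⟩)

theorem bracket_smul_smul (s t : ℂ) (v w : Fin 2 → ℂ) :
    bracket (s • v) (t • w) = s * t * bracket v w := by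
  simp [bracket]; ring

theorem bracket_map (g : (Fin 2 → ℂ) ≃ₗ[ℂ] (Fin 2 → ℂ)) :
    ∃ D : ℂ, ∀ v w, bracket (g v) (g w) = D * bracket v w := by
  refine ⟨bracket (g (Pi.single 0 1)) (g (Pi.single 1 1)), fun v w => ?_⟩
  have h : ∀ v : Fin 2 → ℂ, g v = v 0 • g (Pi.single 0 1) + v 1 • g (Pi.single 1 1) := by
    intro v
    rw [← map_smul, ← map_smul, ← map_add]
    congr 1
    ext k
    fin_cases k <;> simp
  rw [h v, h w]
  simp [bracket]
  ring

theorem bracket_rep_ne_zero {x y : ℙ ℂ (Fin 2 → ℂ)} (h : x ≠ y) : bracket x.rep y.rep ≠ 0 := by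
  intro hb
  apply h
  rw [← x.mk_rep, ← y.mk_rep, Projectivization.mk_eq_mk_iff']
  have hy := y.rep_nonzero
  simp only [bracket] at hb
  by_cases h0 : y.rep 0 = 0
  · have h1 : y.rep 1 ≠ 0 := by
      intro h1
      apply hy
      ext k
      fin_cases k <;> simp [h0, h1]
    refine ⟨x.rep 1 / y.rep 1, ?_⟩
    ext k
    fin_cases k
    · have : x.rep 0 = 0 := by
        rw [h0, mul_zero, sub_zero] at hb
        exact (mul_eq_zero.mp hb).resolve_right h1
      simp [h0, this]
    · simp [h1]
  · refine ⟨x.rep 0 / y.rep 0, ?_⟩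
    ext k
    fin_cases k
    · simp [h0]
    · simp
      field_simp
      linear_combination hb

theorem phiCoord_rep_ne_zero (p : Config) (i : Fin 3) :
    phiCoord (fun k => (p.1 k).rep) i ≠ 0 := by
  intro h
  have h0 := congrFun h 0
  simp only [phiCoord, Pi.zero_apply, div_eq_zero_iff] at h0
  rcases h0 with h0 | h0
  · exact bracket_rep_ne_zero (p.2.ne (by simp)) h0
  · exact bracket_rep_ne_zero (p.2.ne (by simp [Fin.ext_iff])) h0

/-- The map `φ` on 6-tuples of distinct points. -/
def phiConfig (p : Config) : ProdP := fun i =>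
  Projectivization.mk ℂ (phiCoord (fun k => (p.1 k).rep) i) (phiCoord_rep_ne_zero p i)

theorem phiConfig_eq (p q : Config) (h : configSetoid.r p q) : phiConfig p = phiConfig q := by
  obtain ⟨g, hg⟩ := h
  obtain ⟨D, hD⟩ := bracket_map g
  have key : ∀ k, ∃ s : ℂ, (q.1 k).rep = s • g (p.1 k).rep := by
    intro k
    have h1 : Projectivization.mk ℂ (q.1 k).rep (q.1 k).rep_nonzero =
        Projectivization.mk ℂ (g (p.1 k).rep)
          (by simpa using (p.1 k).rep_nonzero) := by
      rw [Projectivization.mk_rep, hg k]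
      conv_lhs => rw [← (p.1 k).mk_rep]
      rfl
    rw [Projectivization.mk_eq_mk_iff'] at h1
    obtain ⟨s, hs⟩ := h1
    exact ⟨s, hs.symm⟩
  choose s hs using key
  have hs0 : ∀ k, s k ≠ 0 := by
    intro k hk
    have := hs k
    rw [hk, zero_smul] at this
    exact (q.1 k).rep_nonzero this
  have hbr : ∀ k l, bracket (q.1 k).rep (q.1 l).rep =
      s k * s l * D * bracket (p.1 k).rep (p.1 l).rep := by
    intro k l
    rw [hs k, hs l, bracket_smul_smul, hD]
    ring
  have hD0 : D ≠ 0 := by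
    intro h0
    have h01 := hbr 0 1
    rw [h0, mul_zero, zero_mul] at h01
    exact bracket_rep_ne_zero (q.2.ne (by decide)) h01
  funext i
  refine ((Projectivization.mk_eq_mk_iff' ℂ _ _ _ _).mpr
    ⟨s 0 / s ⟨i.val + 3, by omega⟩, ?_⟩).symm
  funext j
  have hne : bracket (p.1 ⟨i.val + 3, by omega⟩).rep (p.1 ⟨j.val + 1, by omega⟩).rep ≠ 0 :=
    bracket_rep_ne_zero (p.2.ne (by simp [Fin.ext_iff]; omega))
  have h1 := hs0 ⟨i.val + 3, by omega⟩
  have h2 := hs0 ⟨j.val + 1, by omega⟩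
  simp only [phiCoord, Pi.smul_apply, smul_eq_mul, hbr]
  field_simp

/-- The map `φ : M_{0,6} → ℙ¹ × ℙ² × ℙ³`. -/
def phi : M06 → ProdP :=
  Quotient.lift phiConfig phiConfig_eq

/-! ### The image of the compactification -/

/-- `f` vanishes at the point `x` of `ℙ¹ × ℙ² × ℙ³`. For multihomogeneous `f` this does not depend
on the homogeneous coordinates that represent `x`; it is used only for such `f`. -/
def VanishesAt (f : CoxRing) (x : ProdP) : Prop :=
  MvPolynomial.eval (fun v : Var => (x v.1).rep v.2) f = 0

/-- The Zariski closure of a subset of `ℙ¹ × ℙ² × ℙ³`. -/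
def zariskiClosure (S : Set ProdP) : Set ProdP :=
  {x | ∀ (d : Fin 3 → ℕ) (f : CoxRing), MvPolynomial.IsWeightedHomogeneous multidegree f d →
    (∀ y ∈ S, VanishesAt f y) → VanishesAt f x}

/-- The image of `φ : M̄_{0,6} → ℙ¹ × ℙ² × ℙ³`. As `φ` is a closed embedding of the variety
`M̄_{0,6}`, in which `M_{0,6}` is dense, it is the Zariski closure of `φ(M_{0,6})`. -/
def imageMBar06 : Set ProdP := zariskiClosure (Set.range phi)

/-! ### The ideal that defines a closed subscheme -/

/-- A choice of one homogeneous coordinate on each factor, i.e. a standard affine chart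
`𝔸¹ × 𝔸² × 𝔸³` of `ℙ¹ × ℙ² × ℙ³`. -/
abbrev Chart : Type := ∀ i : Fin 3, Fin (i.val + 2)

/-- The affine coordinates of a chart. -/
abbrev ChartVar (s : Chart) : Type := {v : Var // v.2 ≠ s v.1}

/-- Dehomogenization: the coordinates chosen by `s` are set to 1. -/
def dehomogenize (s : Chart) : CoxRing →ₐ[ℂ] MvPolynomial (ChartVar s) ℂ :=
  MvPolynomial.aeval fun v => if h : v.2 ≠ s v.1 then MvPolynomial.X ⟨v, h⟩ else 1

/-- The homogeneous coordinates of a point of the chart `s` with given affine coordinates. -/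
def chartCoord (s : Chart) (y : ChartVar s → ℂ) (i : Fin 3) (j : Fin (i.val + 2)) : ℂ :=
  if h : j ≠ s i then y ⟨⟨i, j⟩, h⟩ else 1

theorem chartCoord_ne_zero (s : Chart) (y : ChartVar s → ℂ) (i : Fin 3) :
    chartCoord s y i ≠ 0 := by
  intro h
  simpa [chartCoord] using congrFun h (s i)

/-- The inclusion `𝔸¹ × 𝔸² × 𝔸³ → ℙ¹ × ℙ² × ℙ³` of the chart `s`. -/
def chartPoint (s : Chart) (y : ChartVar s → ℂ) : ProdP := fun i =>
  Projectivization.mk ℂ (chartCoord s y i) (chartCoord_ne_zero s y i)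

/-- The multihomogeneous ideal `I` defines the closed set `X`, with its structure of a reduced
subscheme, scheme-theoretically: on each standard affine chart the dehomogenization of `I` is the
ideal of all polynomials that vanish on the part of `X` in the chart. -/
def DefinesSchemeTheoretically (I : Ideal CoxRing) (X : Set ProdP) : Prop :=
  ∀ s : Chart, I.map (dehomogenize s) = MvPolynomial.vanishingIdeal ℂ (chartPoint s ⁻¹' X)

/-- `I` is a `B`-saturated multihomogeneous ideal that defines `X` scheme-theoretically. -/
structure IsSaturatedIdealOf (I : Ideal CoxRing) (X : Set ProdP) : Prop where
  multihomogeneous : IsMultihomogeneous I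
  saturated : IsBSaturated I
  defines : DefinesSchemeTheoretically I X

end MBar06

end

/-! On φ(M_{0,6}) every homogeneous coordinate is a quotient of brackets of distinct points, so none
vanishes and φ(M_{0,6}) lies in every standard chart. Hence the ideal `idealMBar06`, generated by
the forms that vanish on φ(M_{0,6}), is saturated, and on each chart it dehomogenizes to the full
vanishing ideal of the closure. Uniqueness holds for any closed set: a saturated multihomogeneous
ideal is determined by its dehomogenizations (`le_of_map_dehomogenize_le`), because a form that lies
in the ideal on every chart is multiplied into it by a power of B.

The dimensions are squeezed between bounds. Points of φ(M_{0,6}) that impose n independent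
conditions on forms of degree d give dim I_d ≤ dim S_d - n; here 60 - 50 = 10 and 180 - 125 = 55.
Explicit independent elements give the lower bounds: ten in I and nine of them in J for (1,1,2), and
55 in J for (2,2,2). As J ⊆ I, the last bound forces equality in degree (2,2,2). In degree (1,1,2)
the generator f₅ cannot contribute, since its b-degree is 2, and multiples of f₁, …, f₄ span at most
2 + 2 + 2 + 3 = 9 dimensions.

All four independence claims are nonvanishing determinants of integer matrices of values, tested by
elimination modulo 1009. -/

noncomputable section

namespace MBar06

/-! ### Nonvanishing determinants by modular elimination -/

/-- Evaluates all entries of a list before passing the list on. -/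
def forceList {β : Type} (l : List ℕ) : (List ℕ → β) → β :=
  List.rec (motive := fun _ => (List ℕ → β) → β) (fun k => k [])
    (fun x _ ih k => Nat.rec (motive := fun _ => β) (ih fun l => k (0 :: l))
      (fun n _ => ih fun l => k ((n + 1) :: l)) x) l

/-- The recursion on each entry changes no value. It makes reduction evaluate the entry, so that
unevaluated arithmetic does not pile up between elimination steps. -/
theorem forceList_eq {β : Type} (l : List ℕ) (k : List ℕ → β) : forceList l k = k l := by
  induction l generalizing k with
  | nil => rfl
  | cons x l ih => cases x <;> exact ih _

/-- Elimination modulo `p` on `n × n` matrices whose rows are packed into natural numbers in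
base `B`; the entries of the rows are less than `M`. The pivots are on the diagonal. -/
def elim (p B : ℕ) : ℕ → ℕ → List ℕ → Bool
  | 0, _, _ => true
  | _ + 1, _, [] => false
  | n + 1, M, r :: rs =>
    !(r % B % p).beq 0 && (2 * p * M).ble B &&
      forceList (rs.map fun s => (r % B % p * s + (p - s % B % p) * r) / B) (elim p B n (2 * p * M))

/-- The list of digits `l` packed into a natural number in base `B`. -/
def packDigits (B : ℕ) (l : List ℕ) : ℕ := l.foldr (fun x acc => x + B * acc) 0

theorem packDigits_range_succ (B n : ℕ) (e : ℕ → ℕ) :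
    packDigits B ((List.range (n + 1)).map e) =
      e 0 + B * packDigits B ((List.range n).map fun k => e (k + 1)) := by
  simp [packDigits, List.range_succ_eq_map, Function.comp_def]

/-- A row operation on packed rows is plain arithmetic on two natural numbers. Carries matter only
when a digit is read off. -/
theorem packDigits_add_mul (B n h g : ℕ) (e e' : ℕ → ℕ) :
    h * packDigits B ((List.range n).map e) + g * packDigits B ((List.range n).map e') =
      packDigits B ((List.range n).map fun k => h * e k + g * e' k) := by
  induction n generalizing e e' with
  | zero => simp [packDigits]
  | succ n ih =>
    simp only [packDigits_range_succ, ← ih]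
    ring

/-- Each step eliminates the first unknown from the remaining equations. By induction the later
unknowns vanish, and the pivot equation then kills the first. The test `2 * p * M ≤ B` ensures that
digits never carry. -/
theorem eq_zero_of_elim (p B : ℕ) [Fact p.Prime] (n M : ℕ) (E : List (ℕ → ℕ))
    (hE : ∀ e ∈ E, ∀ k < n, e k < M)
    (h : elim p B n M (E.map fun e => packDigits B ((List.range n).map e)) = true)
    (x : ℕ → ZMod p) (hx : ∀ e ∈ E, ∑ k ∈ Finset.range n, (e k : ZMod p) * x k = 0) :
    ∀ k < n, x k = 0 := by
  have hp : 0 < p := (Fact.out : p.Prime).pos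
  induction n generalizing M E x with
  | zero => simp
  | succ n ih =>
    cases E with
    | nil => simp [elim] at h
    | cons e E =>
      simp only [List.map_cons, elim, Bool.and_eq_true, Bool.not_eq_true', Nat.ble_eq,
        forceList_eq, List.map_map] at h
      obtain ⟨⟨hpiv, hMB⟩, hrec⟩ := h
      have digit : ∀ f ∈ e :: E,
          packDigits B ((List.range (n + 1)).map f) % B = f 0 := fun f hf => by
        rw [packDigits_range_succ, Nat.add_mul_mod_self_left,
          Nat.mod_eq_of_lt (((hE f hf 0 (by omega)).trans_le
            (Nat.le_mul_of_pos_left M (Nat.mul_pos two_pos hp))).trans_le hMB)]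
      have hB : 0 < B := by
        have hM : 0 < M := (Nat.zero_le _).trans_lt (hE e (by simp) 0 (by omega))
        exact (Nat.mul_pos (Nat.mul_pos two_pos hp) hM).trans_le hMB
      rw [digit e (by simp)] at hpiv
      have hpiv' : ((e 0 : ℕ) : ZMod p) ≠ 0 := by
        rw [Ne, ZMod.natCast_eq_zero_iff]
        intro hd
        rw [Nat.mod_eq_zero_of_dvd hd] at hpiv
        simp at hpiv
      -- The factor `p - f 0 % p` stands for `-f 0`, to stay in ℕ. Column 0 of the combination is
      -- divisible by `p` and is dropped.
      set step : (ℕ → ℕ) → ℕ → ℕ := fun f k =>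
        e 0 % p * f (k + 1) + (p - f 0 % p) * e (k + 1) with hstep
      have bound : ∀ f ∈ e :: E, ∀ k < n + 1,
          e 0 % p * f k + (p - f 0 % p) * e k < 2 * p * M := fun f hf k hk => by
        have h1 := Nat.mul_lt_mul_of_pos_left (hE f hf k hk) hp
        have h2 := Nat.mul_lt_mul_of_pos_left (hE e (by simp) k hk) hp
        have h3 : e 0 % p * f k ≤ p * f k := Nat.mul_le_mul_right _ (Nat.mod_lt _ hp).le
        have h4 : (p - f 0 % p) * e k ≤ p * e k := Nat.mul_le_mul_right _ (Nat.sub_le _ _)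
        linarith
      have cast_head : ∀ f : ℕ → ℕ, ((p - f 0 % p : ℕ) : ZMod p) = -(f 0 : ZMod p) := fun f => by
        rw [Nat.cast_sub (Nat.mod_lt _ hp).le]
        simp
      have hx0 := hx e (by simp)
      rw [Finset.sum_range_succ'] at hx0
      have key : ∀ k < n, x (k + 1) = 0 := by
        refine ih (2 * p * M) (E.map step) ?_ ?_ (fun k => x (k + 1)) ?_
        · intro f' hf' k hk
          obtain ⟨f, hf, rfl⟩ := List.mem_map.mp hf'
          exact bound f (by simp [hf]) (k + 1) (by omega)
        · rw [← hrec]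
          congr 1
          rw [List.map_map]
          refine List.map_congr_left fun f hf => ?_
          simp only [Function.comp_apply]
          rw [digit e (by simp), digit f (by simp [hf]), packDigits_add_mul,
            packDigits_range_succ, Nat.add_mul_div_left _ _ hB]
          have hlt := bound f (by simp [hf]) 0 (by omega)
          simp only [hstep] at hlt ⊢
          rw [Nat.div_eq_of_lt (hlt.trans_le hMB), zero_add]
        · intro f' hf'
          obtain ⟨f, hf, rfl⟩ := List.mem_map.mp hf'
          have hxf := hx f (by simp [hf])
          rw [Finset.sum_range_succ'] at hxf
          simp only [hstep, Nat.cast_add, Nat.cast_mul, cast_head, ZMod.natCast_mod, add_mul,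
            Finset.sum_add_distrib, mul_assoc, ← Finset.mul_sum]
          linear_combination (e 0 : ZMod p) * hxf - (f 0 : ZMod p) * hx0
      intro k hk
      cases k with
      | succ k => exact key k (by omega)
      | zero =>
        rw [Finset.sum_eq_zero (fun k hk => by rw [key k (Finset.mem_range.mp hk), mul_zero]),
          zero_add] at hx0
        exact (mul_eq_zero.mp hx0).resolve_left hpiv'

/-- The rows of the matrix `N` modulo 1009, packed in base `2 ^ 1400`. -/
def packRows (n : ℕ) (N : ℕ → ℕ → ℕ) : List ℕ :=
  (List.range n).map fun i =>
    packDigits (2 ^ 1400) ((List.range n).map fun j => N i j % 1009)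

/-- Elimination modulo 1009 of the matrix `N`. -/
def elimMatrix (n : ℕ) (N : ℕ → ℕ → ℕ) : Bool :=
  forceList (packRows n N) (elim 1009 (2 ^ 1400) n 1009)

/-- If the determinant vanished, the matrix modulo 1009 would have a nonzero kernel vector, which
elimination excludes. Entries are not reduced between steps, so their bound grows by the factor 2018
each time; 2 ^ 1400 exceeds 1009 · 2018 ^ 125, enough for the largest matrix used. -/
theorem det_ne_zero_of_elimMatrix {n : ℕ} {N : ℕ → ℕ → ℕ} (h : elimMatrix n N = true)
    (A : Matrix (Fin n) (Fin n) ℤ) (hA : ∀ i j, (A i j : ZMod 1009) = N i j) : A.det ≠ 0 := by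
  have : Fact (Nat.Prime 1009) := ⟨by norm_num⟩
  intro hdet
  have hdet' : (A.map (Int.castRingHom (ZMod 1009))).det = 0 := by
    have := RingHom.map_det (Int.castRingHom (ZMod 1009)) A
    rw [hdet, map_zero] at this
    exact this.symm
  obtain ⟨v, hv0, hv⟩ := Matrix.exists_mulVec_eq_zero_iff.mpr hdet'
  apply hv0
  rw [elimMatrix, forceList_eq] at h
  set x : ℕ → ZMod 1009 := fun k => if hk : k < n then v ⟨k, hk⟩ else 0 with hx
  have hxv : ∀ k : Fin n, x k = v k := fun k => by simp [hx]
  have := eq_zero_of_elim 1009 (2 ^ 1400) n 1009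
    ((List.range n).map fun i j => N i j % 1009) ?_ ?_ x ?_
  · ext k
    rw [← hxv, this k k.2, Pi.zero_apply]
  · intro e he k _
    obtain ⟨i, _, rfl⟩ := List.mem_map.mp he
    exact Nat.mod_lt _ (by norm_num)
  · rw [← h, packRows, List.map_map]
    rfl
  · intro e he
    obtain ⟨i, hi, rfl⟩ := List.mem_map.mp he
    have hi' := congrFun hv ⟨i, List.mem_range.mp hi⟩
    rw [Finset.sum_range fun k => ((N i k % 1009 : ℕ) : ZMod 1009) * x k]
    simpa [Matrix.mulVec, dotProduct, hA, hxv] using hi'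

/-! ### Multihomogeneous polynomials -/

open MvPolynomial

theorem weight_multidegree_apply (e : Var →₀ ℕ) (i : Fin 3) :
    Finsupp.weight multidegree e i = ∑ j, e ⟨i, j⟩ := by
  rw [Finsupp.weight_apply, Finsupp.sum_fintype _ _ (by simp), Finset.sum_apply,
    Fintype.sum_sigma, Finset.sum_eq_single i]
  · simp [multidegree]
  · intro k _ hk
    simp [multidegree, hk.symm]
  · simp

theorem eval_mul_of_isWeightedHomogeneous {f : CoxRing} {d : Fin 3 → ℕ}
    (hf : IsWeightedHomogeneous multidegree f d) (t : Fin 3 → ℂ) (w : Var → ℂ) :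
    eval (fun v => t v.1 * w v) f = (∏ i, t i ^ d i) * eval w f := by
  rw [eval_eq', eval_eq', Finset.mul_sum]
  refine Finset.sum_congr rfl fun e he => ?_
  have hd := hf (mem_support_iff.mp he)
  have : ∏ v : Var, (t v.1 * w v) ^ e v = (∏ i, t i ^ d i) * ∏ v : Var, w v ^ e v := by
    simp only [mul_pow, Finset.prod_mul_distrib]
    congr 1
    rw [Fintype.prod_sigma]
    refine Finset.prod_congr rfl fun i _ => ?_
    change ∏ j, t i ^ e ⟨i, j⟩ = _
    rw [Finset.prod_pow_eq_pow_sum, ← hd, weight_multidegree_apply]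
  rw [this]
  ring

/-- Rescaling the coordinates of each factor multiplies a form by a nonzero scalar, so any
representatives may replace `rep`. -/
theorem vanishesAt_iff {f : CoxRing} {d : Fin 3 → ℕ}
    (hf : IsWeightedHomogeneous multidegree f d) {x : ProdP}
    {w : ∀ i : Fin 3, Fin (i.val + 2) → ℂ} (hw : ∀ i, w i ≠ 0)
    (hx : ∀ i, x i = Projectivization.mk ℂ (w i) (hw i)) :
    VanishesAt f x ↔ eval (fun v : Var => w v.1 v.2) f = 0 := by
  have h1 : ∀ i, ∃ s : ℂ, s • w i = (x i).rep := fun i => by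
    rw [← Projectivization.mk_eq_mk_iff' ℂ _ _ (x i).rep_nonzero (hw i), Projectivization.mk_rep,
      hx i]
  choose t ht using h1
  have ht0 : ∀ i, t i ≠ 0 := fun i h0 => (x i).rep_nonzero (by rw [← ht i, h0, zero_smul])
  have h2 : (fun v : Var => (x v.1).rep v.2) = fun v => t v.1 * w v.1 v.2 := by
    funext v
    rw [← ht v.1, Pi.smul_apply, smul_eq_mul]
  rw [VanishesAt, h2, eval_mul_of_isWeightedHomogeneous hf t fun v => w v.1 v.2, mul_eq_zero,
    or_iff_right (Finset.prod_ne_zero_iff.mpr fun i _ => pow_ne_zero _ (ht0 i))]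

/-! ### Charts -/

/-- The monomial of multidegree `d` in the coordinates chosen by the chart `s`. -/
def chartMonomial (s : Chart) (d : Fin 3 → ℕ) : CoxRing := ∏ i, X (⟨i, s i⟩ : Var) ^ d i

theorem isWeightedHomogeneous_chartMonomial (s : Chart) (d : Fin 3 → ℕ) :
    IsWeightedHomogeneous multidegree (chartMonomial s d) d := by
  have := IsWeightedHomogeneous.prod (w := multidegree) Finset.univ
    (fun i => X (R := ℂ) (⟨i, s i⟩ : Var) ^ d i)
    (fun i => d i • multidegree ⟨i, s i⟩)
    (fun i _ => (isWeightedHomogeneous_X ℂ multidegree (⟨i, s i⟩ : Var)).pow _)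
  have hd : d = ∑ i, d i • multidegree ⟨i, s i⟩ := by
    ext i
    simp [multidegree, Finset.sum_apply, Pi.single_apply]
  rw [← hd] at this
  exact this

theorem dehomogenize_chartMonomial (s : Chart) (d : Fin 3 → ℕ) :
    dehomogenize s (chartMonomial s d) = 1 := by
  simp [dehomogenize, chartMonomial]

theorem eval_dehomogenize (s : Chart) (y : ChartVar s → ℂ) (f : CoxRing) :
    eval y (dehomogenize s f) = eval (fun v : Var => chartCoord s y v.1 v.2) f := by
  have : ((aeval y).comp (dehomogenize s) : CoxRing →ₐ[ℂ] ℂ) =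
      aeval fun v : Var => chartCoord s y v.1 v.2 := by
    ext v
    simp only [dehomogenize, AlgHom.comp_apply, aeval_X, chartCoord]
    split_ifs <;> simp
  simpa [aeval_eq_eval] using DFunLike.congr_fun this f

theorem dehomogenize_surjective (s : Chart) : Function.Surjective (dehomogenize s) := by
  intro g
  refine ⟨rename Subtype.val g, ?_⟩
  have : (dehomogenize s).comp (rename Subtype.val) = AlgHom.id ℂ _ := by
    ext v
    simp [dehomogenize, v.2]
  exact DFunLike.congr_fun this g

/-- A point at which the coordinates chosen by `s` do not vanish lies in the chart `s`. -/
theorem exists_chartPoint_eq (s : Chart) (x : ProdP) (hx : ∀ i, (x i).rep (s i) ≠ 0) :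
    ∃ y, chartPoint s y = x := by
  refine ⟨fun v => (x v.1.1).rep v.1.2 / (x v.1.1).rep (s v.1.1), ?_⟩
  funext i
  conv_rhs => rw [← (x i).mk_rep]
  refine (Projectivization.mk_eq_mk_iff' ℂ _ _ _ _).mpr ⟨((x i).rep (s i))⁻¹, ?_⟩
  funext j
  by_cases h : j = s i
  · subst h
    simp [chartCoord, hx i]
  · simp [chartCoord, h, div_eq_inv_mul]

theorem vanishesAt_chartPoint {f : CoxRing} {d : Fin 3 → ℕ}
    (hf : IsWeightedHomogeneous multidegree f d) (s : Chart) (y : ChartVar s → ℂ) :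
    VanishesAt f (chartPoint s y) ↔ eval y (dehomogenize s f) = 0 := by
  rw [eval_dehomogenize]
  exact vanishesAt_iff hf (chartCoord_ne_zero s y) fun _ => rfl

/-- By rescaling, `f` vanishes wherever the coordinates chosen by `s` are all nonzero. Its product
with these coordinates vanishes everywhere, hence is zero, and the Cox ring is a domain. -/
theorem eq_zero_of_dehomogenize_eq_zero {f : CoxRing} {d : Fin 3 → ℕ}
    (hf : IsWeightedHomogeneous multidegree f d) (s : Chart) (h : dehomogenize s f = 0) :
    f = 0 := by
  have hprod : f * ∏ i, X (⟨i, s i⟩ : Var) = 0 := by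
    refine MvPolynomial.funext fun w => ?_
    rw [map_mul, map_prod, map_zero]
    simp only [eval_X]
    by_cases hw : ∏ i, w ⟨i, s i⟩ = 0
    · rw [hw, mul_zero]
    have hw' : ∀ i, w ⟨i, s i⟩ ≠ 0 := fun i =>
      Finset.prod_ne_zero_iff.mp hw i (Finset.mem_univ i)
    have h1 := eval_dehomogenize s (fun v => w v.1 / w ⟨v.1.1, s v.1.1⟩) f
    rw [h, map_zero] at h1
    have h2 := eval_mul_of_isWeightedHomogeneous hf (fun i => w ⟨i, s i⟩) (fun v : Var =>
      chartCoord s (fun v => w v.1 / w ⟨v.1.1, s v.1.1⟩) v.1 v.2)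
    rw [← h1, mul_zero] at h2
    rw [mul_eq_zero]
    left
    refine Eq.trans (congrArg (fun z => eval z f) (_root_.funext ?_)) h2
    rintro ⟨i, j⟩
    by_cases hj : j = s i
    · subst hj
      simp [chartCoord]
    · simp only [chartCoord, ne_eq, hj, not_false_eq_true, dite_true]
      field_simp [hw' i]
  refine (mul_eq_zero.mp hprod).resolve_right ?_
  exact Finset.prod_ne_zero_iff.mpr fun i _ => X_ne_zero _

/-- Elements that lie in the dehomogenization of a multihomogeneous ideal are dehomogenizations of
multihomogeneous elements of the ideal. -/
theorem exists_isWeightedHomogeneous_dehomogenize_eq {I : Ideal CoxRing}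
    (hI : IsMultihomogeneous I) (s : Chart) {g : CoxRing} (hg : g ∈ I) :
    ∃ (d : Fin 3 → ℕ) (f : CoxRing), f ∈ I ∧ IsWeightedHomogeneous multidegree f d ∧
      dehomogenize s f = dehomogenize s g := by
  classical
  have key : ∀ (A : Finset (Fin 3 → ℕ)), ∃ (d : Fin 3 → ℕ) (f : CoxRing), f ∈ I ∧
      IsWeightedHomogeneous multidegree f d ∧ dehomogenize s f =
        dehomogenize s (∑ e ∈ A, weightedHomogeneousComponent multidegree e g) := by
    intro A
    induction A using Finset.induction_on with
    | empty => exact ⟨0, 0, I.zero_mem, isWeightedHomogeneous_zero _ _ _, by simp⟩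
    | insert e A he ih =>
      obtain ⟨d, f, hfI, hf, hfA⟩ := ih
      -- Chart monomials dehomogenize to 1, so they bring both summands to a common degree without
      -- changing their dehomogenizations.
      refine ⟨d + e, f * chartMonomial s e +
        weightedHomogeneousComponent multidegree e g * chartMonomial s d,
        I.add_mem (I.mul_mem_right _ hfI) (I.mul_mem_right _ (hI g hg e)), ?_, ?_⟩
      · refine (hf.mul (isWeightedHomogeneous_chartMonomial s e)).add ?_
        rw [add_comm d e]
        exact (weightedHomogeneousComponent_isWeightedHomogeneous (w := multidegree) e g).mul
          (isWeightedHomogeneous_chartMonomial s d)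
      · rw [Finset.sum_insert he, map_add, map_add, map_mul, map_mul, dehomogenize_chartMonomial,
          dehomogenize_chartMonomial, hfA, mul_one, mul_one, add_comm]
  obtain ⟨d, f, h⟩ := key (weightedHomogeneousComponent_finsupp (w := multidegree) g).toFinset
  rw [← finsum_eq_sum _ (weightedHomogeneousComponent_finsupp g),
    finsum_weightedHomogeneousComponent] at h
  exact ⟨d, f, h⟩

theorem mem_of_forall_component_mem {I : Ideal CoxRing} {f : CoxRing}
    (h : ∀ d, weightedHomogeneousComponent multidegree d f ∈ I) : f ∈ I := by
  rw [← finsum_weightedHomogeneousComponent multidegree f,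
    finsum_eq_sum _ (weightedHomogeneousComponent_finsupp f)]
  exact I.sum_mem fun d _ => h d

/-- The cube of an element of an intersection of three ideals lies in their product, here generated
by the monomials `a i * b j * c k`. -/
theorem irrelevantIdeal_le_radical {K : Ideal CoxRing}
    (h : ∀ s : Chart, chartMonomial s 1 ∈ K.radical) : irrelevantIdeal ≤ K.radical := by
  have hprod : Ideal.span (Set.range a) * Ideal.span (Set.range b) * Ideal.span (Set.range c) ≤
      K.radical := by
    rw [Ideal.span_mul_span', Ideal.span_mul_span', Ideal.span_le]
    rintro _ ⟨_, ⟨_, ⟨i, rfl⟩, _, ⟨j, rfl⟩, rfl⟩, _, ⟨k, rfl⟩, rfl⟩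
    have := h (Fin.cons i (Fin.cons j (Fin.cons k finZeroElim)))
    rw [chartMonomial, Fin.prod_univ_three] at this
    simp only [Pi.one_apply, pow_one] at this
    exact this
  intro f hf
  have h3 : f ^ 3 ∈ K.radical := by
    apply hprod
    rw [pow_succ, pow_two]
    exact Ideal.mul_mem_mul (Ideal.mul_mem_mul hf.1.1 hf.1.2) hf.2
  exact K.radical_isRadical ⟨3, h3⟩

/-- A multihomogeneous ideal is contained in a saturated one if this holds on all charts. -/
theorem le_of_map_dehomogenize_le {I I' : Ideal CoxRing} (hI : IsMultihomogeneous I)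
    (hI' : IsMultihomogeneous I') (hsat : IsBSaturated I')
    (h : ∀ s, I.map (dehomogenize s) ≤ I'.map (dehomogenize s)) : I ≤ I' := by
  intro f' hf'
  refine mem_of_forall_component_mem fun d => ?_
  set f := weightedHomogeneousComponent multidegree d f'
  have hf : IsWeightedHomogeneous multidegree f d :=
    weightedHomogeneousComponent_isWeightedHomogeneous d f'
  have hfI : f ∈ I := hI f' hf' d
  -- It suffices that each `a i * b j * c k` has a power that multiplies `f` into `I'`; as B is
  -- finitely generated, a power of B then does so.
  have hrad : irrelevantIdeal ≤ (Submodule.colon I' {f}).radical := by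
    refine irrelevantIdeal_le_radical fun s => ?_
    have h1 := h s (Ideal.mem_map_of_mem _ hfI)
    rw [Ideal.mem_map_iff_of_surjective _ (dehomogenize_surjective s)] at h1
    obtain ⟨g', hg', hgf⟩ := h1
    obtain ⟨e, g, hg, hge, hgg⟩ := exists_isWeightedHomogeneous_dehomogenize_eq hI' s hg'
    -- Two forms of the same degree with the same dehomogenization are equal.
    have h2 : chartMonomial s e * f - chartMonomial s d * g = 0 := by
      refine eq_zero_of_dehomogenize_eq_zero (d := e + d) ?_ s ?_
      · refine ((isWeightedHomogeneous_chartMonomial s e).mul hf).sub ?_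
        rw [add_comm]
        exact (isWeightedHomogeneous_chartMonomial s d).mul hge
      · rw [map_sub, map_mul, map_mul, dehomogenize_chartMonomial, dehomogenize_chartMonomial,
          one_mul, one_mul, hgg, hgf, sub_self]
    have h3 : chartMonomial s e ∈ Submodule.colon I' {f} := by
      rw [Submodule.mem_colon_singleton, smul_eq_mul, sub_eq_zero.mp h2]
      exact I'.mul_mem_left _ hg
    refine ⟨∑ i, e i, ?_⟩
    have h4 : chartMonomial s 1 ^ (∑ i, e i) =
        chartMonomial s (fun i => ∑ k, e k - e i) * chartMonomial s e := by
      simp only [chartMonomial, ← Finset.prod_mul_distrib, ← pow_add, ← Finset.prod_pow]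
      refine Finset.prod_congr rfl fun i _ => ?_
      rw [Nat.sub_add_cancel (Finset.single_le_sum (fun _ _ => Nat.zero_le _) (Finset.mem_univ i))]
      simp
    rw [h4]
    exact Ideal.mul_mem_left _ _ h3
  obtain ⟨N, hN⟩ := Ideal.exists_pow_le_of_le_radical_of_fg hrad
    (IsNoetherian.noetherian irrelevantIdeal)
  refine hsat N f fun g hg => ?_
  have := hN hg
  rwa [Submodule.mem_colon_singleton, smul_eq_mul] at this

/-! ### The saturated ideal -/

theorem weightedHomogeneousComponent_mul {f : CoxRing} {e : Fin 3 → ℕ}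
    (hf : IsWeightedHomogeneous multidegree f e) (g : CoxRing) (m : Fin 3 → ℕ) :
    weightedHomogeneousComponent multidegree m (f * g) =
      if ∀ i, e i ≤ m i then f * weightedHomogeneousComponent multidegree (m - e) g else 0 := by
  classical
  have hg := finsum_weightedHomogeneousComponent multidegree g
  rw [finsum_eq_sum _ (weightedHomogeneousComponent_finsupp g)] at hg
  set A := (weightedHomogeneousComponent_finsupp (w := multidegree) g).toFinset with hA
  have h1 : ∀ k, weightedHomogeneousComponent multidegree m
      (f * weightedHomogeneousComponent multidegree k g) =
        if m = e + k then f * weightedHomogeneousComponent multidegree k g else 0 := fun k =>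
    weightedHomogeneousComponent_of_mem
      (hf.mul (weightedHomogeneousComponent_isWeightedHomogeneous (w := multidegree) k g))
  conv_lhs => rw [← hg, Finset.mul_sum, map_sum]
  simp only [h1]
  split_ifs with hem
  · have h2 : ∀ k, m = e + k ↔ k = m - e := fun k =>
      ⟨fun h => by rw [h, add_tsub_cancel_left], fun h => by rw [h, add_tsub_cancel_of_le (show e ≤ m from hem)]⟩
    simp only [h2, Finset.sum_ite_eq']
    split_ifs with h
    · rfl
    · have : weightedHomogeneousComponent multidegree (m - e) g = 0 := by
        by_contra h0
        exact h ((Set.Finite.mem_toFinset _).mpr h0)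
      rw [this, mul_zero]
  · refine Finset.sum_eq_zero fun k _ => if_neg ?_
    rintro rfl
    exact hem fun i => Nat.le_add_right _ _

/-- The ideal generated by the multihomogeneous polynomials that vanish on the image of `φ`. -/
def idealMBar06 : Ideal CoxRing :=
  Ideal.span {f | ∃ d, IsWeightedHomogeneous multidegree f d ∧ ∀ x ∈ Set.range phi, VanishesAt f x}

theorem isMultihomogeneous_span {A : Set CoxRing}
    (hA : ∀ f ∈ A, ∃ d, IsWeightedHomogeneous multidegree f d) :
    IsMultihomogeneous (Ideal.span A) := by
  classical
  let _ := weightedGradedAlgebra ℂ multidegree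
  intro f hf d
  exact weightedHomogeneousComponent_mem_of_mem ℂ multidegree
    (Ideal.homogeneous_span _ A hA) hf d

theorem isMultihomogeneous_idealMBar06 : IsMultihomogeneous idealMBar06 :=
  isMultihomogeneous_span fun _ ⟨d, hd, _⟩ => ⟨d, hd⟩

theorem vanishesAt_of_mem_idealMBar06 {f : CoxRing} (hf : f ∈ idealMBar06) {x : ProdP}
    (hx : x ∈ Set.range phi) : VanishesAt f x := by
  have : idealMBar06 ≤ RingHom.ker (eval fun v : Var => (x v.1).rep v.2) :=
    Ideal.span_le.mpr fun g ⟨_, _, hg⟩ => hg x hx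
  exact this hf

theorem mem_idealMBar06_of_vanishesAt {f : CoxRing} {d : Fin 3 → ℕ}
    (hf : IsWeightedHomogeneous multidegree f d) (h : ∀ x ∈ Set.range phi, VanishesAt f x) :
    f ∈ idealMBar06 :=
  Ideal.subset_span ⟨d, hf, h⟩

theorem vanishesAt_phiConfig_iff {f : CoxRing} {d : Fin 3 → ℕ}
    (hf : IsWeightedHomogeneous multidegree f d) (p : Config) :
    VanishesAt f (phiConfig p) ↔
      eval (fun v : Var => phiCoord (fun k => (p.1 k).rep) v.1 v.2) f = 0 :=
  vanishesAt_iff hf (phiCoord_rep_ne_zero p) fun _ => rfl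

theorem forall_range_phi {P : ProdP → Prop} :
    (∀ x ∈ Set.range phi, P x) ↔ ∀ p : Config, P (phiConfig p) :=
  ⟨fun h p => h _ ⟨Quotient.mk _ p, rfl⟩, by
    rintro h _ ⟨q, rfl⟩
    induction q using Quotient.inductionOn with
    | h p => exact h p⟩

theorem rep_ne_zero_of_mem_range_phi {x : ProdP} (hx : x ∈ Set.range phi) (i : Fin 3)
    (j : Fin (i.val + 2)) : (x i).rep j ≠ 0 := by
  revert x
  rw [forall_range_phi]
  intro p h
  have h1 : VanishesAt (X (⟨i, j⟩ : Var)) (phiConfig p) := by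
    rw [VanishesAt, eval_X]
    exact h
  rw [vanishesAt_phiConfig_iff (isWeightedHomogeneous_X ℂ multidegree _), eval_X, phiCoord,
    div_eq_zero_iff] at h1
  rcases h1 with h1 | h1
  · exact bracket_rep_ne_zero (p.2.ne (Fin.ne_of_val_ne (Nat.succ_ne_zero _).symm)) h1
  · exact bracket_rep_ne_zero (p.2.ne fun h => by have := congrArg Fin.val h; simp at this; omega) h1

/-- The monomial a₀b₀c₀ lies in B and vanishes nowhere on φ(M_{0,6}), so its powers can be cancelled
from vanishing conditions, one multidegree at a time. -/
theorem isBSaturated_idealMBar06 : IsBSaturated idealMBar06 := by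
  intro N f hf
  set g := chartMonomial 0 1 with hg
  have hgW := (isWeightedHomogeneous_chartMonomial 0 1).pow N
  have hgB : g ∈ irrelevantIdeal := by
    have : g = a 0 * b 0 * c 0 := by
      simp only [hg, chartMonomial, Fin.prod_univ_three, Pi.one_apply, pow_one]
      rfl
    rw [this]
    refine ⟨⟨?_, ?_⟩, ?_⟩
    · exact Ideal.mul_mem_right _ _ (Ideal.mul_mem_right _ _ (Ideal.subset_span ⟨0, rfl⟩))
    · exact Ideal.mul_mem_right _ _ (Ideal.mul_mem_left _ _ (Ideal.subset_span ⟨0, rfl⟩))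
    · exact Ideal.mul_mem_left _ _ (Ideal.subset_span ⟨0, rfl⟩)
  refine mem_of_forall_component_mem fun d => mem_idealMBar06_of_vanishesAt
    (weightedHomogeneousComponent_isWeightedHomogeneous d f) fun x hx => ?_
  have h1 := isMultihomogeneous_idealMBar06 _ (hf (g ^ N) (Ideal.pow_mem_pow hgB N))
    (N • (1 : Fin 3 → ℕ) + d)
  rw [weightedHomogeneousComponent_mul hgW, if_pos (show ∀ i, (N • (1 : Fin 3 → ℕ)) i ≤ (N • (1 : Fin 3 → ℕ) + d) i from
    fun i => Nat.le_add_right _ _), add_tsub_cancel_left] at h1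
  have h2 := vanishesAt_of_mem_idealMBar06 h1 hx
  rw [VanishesAt, map_mul, map_pow, chartMonomial, map_prod] at h2
  refine (mul_eq_zero.mp h2).resolve_left (pow_ne_zero _ (Finset.prod_ne_zero_iff.mpr ?_))
  intro i _
  rw [map_pow, eval_X]
  exact pow_ne_zero _ (rep_ne_zero_of_mem_range_phi hx _ _)

theorem exists_homogenization (s : Chart) (g : MvPolynomial (ChartVar s) ℂ) :
    ∃ (d : Fin 3 → ℕ) (f : CoxRing), IsWeightedHomogeneous multidegree f d ∧
      dehomogenize s f = g := by
  obtain ⟨f, rfl⟩ := dehomogenize_surjective s g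
  obtain ⟨d, f', -, h⟩ := exists_isWeightedHomogeneous_dehomogenize_eq (I := ⊤)
    (fun _ _ _ => Submodule.mem_top) s (g := f) Submodule.mem_top
  exact ⟨d, f', h⟩

/-- For the harder inclusion, a polynomial vanishing on the image in one chart is homogenized; the
form vanishes on all of φ(M_{0,6}), which lies inside that chart. -/
theorem definesSchemeTheoretically_idealMBar06 :
    DefinesSchemeTheoretically idealMBar06 imageMBar06 := by
  intro s
  apply le_antisymm
  · rw [Ideal.map_le_iff_le_comap]
    refine Ideal.span_le.mpr fun f ⟨d, hf, hv⟩ => ?_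
    change dehomogenize s f ∈ vanishingIdeal ℂ _
    rw [mem_vanishingIdeal_iff]
    intro y hy
    rw [aeval_eq_eval]
    exact (vanishesAt_chartPoint hf s y).mp (hy d f hf hv)
  · intro g hg
    obtain ⟨d, f, hf, rfl⟩ := exists_homogenization s g
    refine Ideal.mem_map_of_mem _ (mem_idealMBar06_of_vanishesAt hf fun x hx => ?_)
    obtain ⟨y, rfl⟩ := exists_chartPoint_eq s x fun i => rep_ne_zero_of_mem_range_phi hx i _
    rw [vanishesAt_chartPoint hf]
    rw [mem_vanishingIdeal_iff] at hg
    have := hg y fun _ _ _ h => h _ hx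
    rwa [aeval_eq_eval] at this

theorem isSaturatedIdealOf_idealMBar06 : IsSaturatedIdealOf idealMBar06 imageMBar06 :=
  ⟨isMultihomogeneous_idealMBar06, isBSaturated_idealMBar06, definesSchemeTheoretically_idealMBar06⟩

theorem IsSaturatedIdealOf.unique {I I' : Ideal CoxRing} {X : Set ProdP}
    (hI : IsSaturatedIdealOf I X) (hI' : IsSaturatedIdealOf I' X) : I = I' :=
  le_antisymm
    (le_of_map_dehomogenize_le hI.1 hI'.1 hI'.2 fun s => ((hI.3 s).trans (hI'.3 s).symm).le)
    (le_of_map_dehomogenize_le hI'.1 hI.1 hI.2 fun s => ((hI'.3 s).trans (hI.3 s).symm).le)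

/-! ### Points of the image of `φ` with integral coordinates -/

/-- The position of a coordinate in the list `a₀, a₁, b₀, b₁, b₂, c₀, c₁, c₂, c₃`. -/
def varIndex (v : Var) : ℕ := ![0, 2, 5] v.1 + v.2

/-- The coordinates of `φ(∞, 0, 1, 1 + r, 1 + r + s, 1 + r + s + t)`, without denominators. -/
def gapPoint (r s t : ℕ) (k : ℕ) : ℕ :=
  [r, 1 + r,
    s * (r + s), s * (1 + r + s), (r + s) * (1 + r + s),
    t * (s + t) * (r + s + t), t * (s + t) * (1 + r + s + t),
    t * (r + s + t) * (1 + r + s + t), (s + t) * (r + s + t) * (1 + r + s + t)].getD k 0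

theorem phiCoord_smul (v : Fin 6 → Fin 2 → ℂ) (t : Fin 6 → ℂ) (ht : ∀ k, t k ≠ 0) (i : Fin 3)
    (j : Fin (i.val + 2)) :
    phiCoord (fun k => t k • v k) i j = t 0 / t ⟨i.val + 3, by omega⟩ * phiCoord v i j := by
  have h2 := ht ⟨j.val + 1, by omega⟩
  simp only [phiCoord, bracket_smul_smul]
  rw [mul_right_comm, mul_right_comm (t ⟨i.val + 3, _⟩), mul_div_mul_right _ _ h2,
    mul_div_mul_comm]

/-- With p₁ = ∞ the coordinates of φ become reciprocals of differences of the other points. Positive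
gaps keep the points distinct. -/
theorem eval_gapPoint_eq_zero {f : CoxRing} {d : Fin 3 → ℕ}
    (hf : IsWeightedHomogeneous multidegree f d) (hI : f ∈ idealMBar06) {r s t : ℕ} (hr : 0 < r)
    (hs : 0 < s) (ht : 0 < t) : eval (fun v => (gapPoint r s t (varIndex v) : ℂ)) f = 0 := by
  set y : Fin 5 → ℕ := ![0, 1, 1 + r, 1 + r + s, 1 + r + s + t] with hy
  set v : Fin 6 → Fin 2 → ℂ := Fin.cons ![1, 0] fun k => ![(y k : ℂ), 1] with hv
  have hymono : StrictMono y := by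
    rw [Fin.strictMono_iff_lt_succ]
    intro i
    fin_cases i <;> simp [hy] <;> omega
  have hv0 : ∀ k, v k ≠ 0 := by
    intro k h
    induction k using Fin.cases with
    | zero => simpa [hv] using congrFun h 0
    | succ k => simpa [hv] using congrFun h 1
  set p : Fin 6 → ℙ ℂ (Fin 2 → ℂ) := fun k => Projectivization.mk ℂ (v k) (hv0 k) with hp
  have hpinj : Function.Injective p := by
    intro k l hkl
    rw [hp, Projectivization.mk_eq_mk_iff'] at hkl
    obtain ⟨u, hu⟩ := hkl
    induction k using Fin.cases with
    | zero =>
      induction l using Fin.cases with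
      | zero => rfl
      | succ l =>
        have h1 := congrFun hu 0
        have h2 := congrFun hu 1
        simp [hv] at h1 h2
        simp [h2] at h1
    | succ k =>
      induction l using Fin.cases with
      | zero => simpa [hv] using congrFun hu 1
      | succ l =>
        have h1 := congrFun hu 0
        have h2 := congrFun hu 1
        simp [hv] at h1 h2
        simp only [h2, one_mul, Nat.cast_inj] at h1
        rw [hymono.injective h1]
  have hrep : ∀ k, ∃ u : ℂ, u • v k = (p k).rep := fun k => by
    rw [← Projectivization.mk_eq_mk_iff' ℂ _ _ (p k).rep_nonzero (hv0 k), Projectivization.mk_rep]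
  choose u hu using hrep
  have hu0 : ∀ k, u k ≠ 0 := fun k h0 => (p k).rep_nonzero (by rw [← hu k, h0, zero_smul])
  have h1 := (vanishesAt_phiConfig_iff hf ⟨p, hpinj⟩).mp
    (vanishesAt_of_mem_idealMBar06 hI ⟨Quotient.mk _ ⟨p, hpinj⟩, rfl⟩)
  simp only [← hu, phiCoord_smul v u hu0] at h1
  rw [eval_mul_of_isWeightedHomogeneous hf (fun i => u 0 / u ⟨i.val + 3, by omega⟩)
    (fun w : Var => phiCoord v w.1 w.2), mul_eq_zero, or_iff_right (Finset.prod_ne_zero_iff.mpr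
      fun i _ => pow_ne_zero _ (div_ne_zero (hu0 _) (hu0 _)))] at h1
  -- On each factor, the product of all denominators.
  set D : Fin 3 → ℂ := ![(r : ℂ) * (1 + r), s * (r + s) * (1 + r + s),
    t * (s + t) * (r + s + t) * (1 + r + s + t)] with hD
  have h2 := eval_mul_of_isWeightedHomogeneous hf D (fun w : Var => phiCoord v w.1 w.2)
  rw [h1, mul_zero] at h2
  have hne : ∀ (i : Fin 3) (j : Fin (i.val + 2)),
      (y ⟨i.val + 2, by omega⟩ - y ⟨j.val, by omega⟩ : ℂ) ≠ 0 := fun i j => by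
    rw [sub_ne_zero, Ne, Nat.cast_inj]
    exact (hymono (Fin.mk_lt_mk.mpr j.2)).ne'
  have hc : ∀ (i : Fin 3) (j : Fin (i.val + 2)),
      phiCoord v i j = 1 / (y ⟨i.val + 2, by omega⟩ - y ⟨j.val, by omega⟩ : ℂ) := fun i j => by
    have hs : ∀ (k : ℕ) (hk : k + 1 < 6), v ⟨k + 1, hk⟩ = ![(y ⟨k, by omega⟩ : ℂ), 1] :=
      fun _ _ => rfl
    rw [phiCoord, hs, hs]
    simp [hv, bracket]
  refine Eq.trans (congrArg (fun z => eval z f) (_root_.funext ?_)) h2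
  rintro ⟨i, j⟩
  change _ = D i * phiCoord v i j
  rw [hc, mul_one_div, eq_div_iff (hne i j)]
  fin_cases i <;> fin_cases j <;> simp [varIndex, gapPoint, hy, hD] <;> ring

/-! ### Families of test polynomials -/

/-- The coefficients of the `j`-th test form. -/
def testVec (j k : ℕ) : ℕ := (j + 2) ^ (k + 1) % 131

/-- A product of powers of linear forms in the three groups of coordinates. -/
def form {R : Type} [CommSemiring R] (d : ℕ × ℕ × ℕ) (u : ℕ → ℕ) (x : ℕ → R) : R :=
  (u 0 * x 0 + u 1 * x 1) ^ d.1 * (u 2 * x 2 + u 3 * x 3 + u 4 * x 4) ^ d.2.1 *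
    (u 5 * x 5 + u 6 * x 6 + u 7 * x 7 + u 8 * x 8) ^ d.2.2

/-- The generators `f₁, …, f₅` of `J₆`, a polynomial of multidegree `(1, 1, 2)`, and `1`,
at `m = -1`. -/
def gen {R : Type} [CommSemiring R] (m : R) (k : ℕ) (x : ℕ → R) : R :=
  match k with
  | 0 => x 3 * x 6 * x 7 + m * (x 4 * x 6 * x 7) + x 4 * x 6 * x 8 + m * (x 3 * x 7 * x 8)
  | 1 => x 2 * x 5 * x 7 + m * (x 4 * x 5 * x 7) + x 4 * x 5 * x 8 + m * (x 2 * x 7 * x 8)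
  | 2 => x 2 * x 5 * x 6 + m * (x 3 * x 5 * x 6) + x 3 * x 5 * x 8 + m * (x 2 * x 6 * x 8)
  | 3 => x 0 * x 5 * x 6 + m * (x 1 * x 5 * x 6) + x 1 * x 5 * x 7 + m * (x 0 * x 6 * x 7)
  | 4 => x 0 * x 2 * x 3 + m * (x 1 * x 2 * x 3) + x 1 * x 2 * x 4 + m * (x 0 * x 3 * x 4)
  | 5 => x 0 * x 3 * x 5 * x 8 + x 1 * x 4 * x 5 * x 8 + m * (x 1 * x 4 * x 5 * x 7) +
      m * (x 1 * x 3 * x 5 * x 8) + x 1 * x 3 * x 5 * x 7 + m * (x 0 * x 3 * x 7 * x 8)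
  | _ => 1

theorem map_form {R S : Type} [CommSemiring R] [CommSemiring S] (F : R →+* S) (d : ℕ × ℕ × ℕ)
    (u : ℕ → ℕ) {x : ℕ → R} {y : ℕ → S} (h : ∀ k < 9, F (x k) = y k) :
    F (form d u x) = form d u y := by
  simp [form, h]

/-- The sign is a parameter so that the same expression makes sense in ℕ, with 1008 in the role of
-1 modulo 1009. -/
theorem map_gen {R S : Type} [CommSemiring R] [CommSemiring S] (F : R →+* S) {m : R} {m' : S}
    (hm : F m = m') (k : ℕ) {x : ℕ → R} {y : ℕ → S} (h : ∀ k < 9, F (x k) = y k) :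
    F (gen m k x) = gen m' k y := by
  unfold gen
  split <;> simp [h, hm]

/-- The homogeneous coordinates in the order of `varIndex`. -/
def coord (k : ℕ) : CoxRing := [a 0, a 1, b 0, b 1, b 2, c 0, c 1, c 2, c 3].getD k 0

theorem eval_coord (q : ℕ → ℂ) : ∀ k < 9, eval (fun v => q (varIndex v)) (coord k) = q k := by
  intro k hk
  interval_cases k <;> simp [coord, a, b, c, varIndex]

/-- Multidegrees of the multiplier and index of the factor `gen` in a family of polynomials. -/
abbrev FamilyType : Type := ℕ → (ℕ × ℕ × ℕ) × ℕ

/-- The value of the `j`-th polynomial of a family. -/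
def famValue {R : Type} [CommSemiring R] (m : R) (T : FamilyType) (j : ℕ) (x : ℕ → R) : R :=
  form (T j).1 (testVec j) x * gen m (T j).2 x

theorem map_famValue {R S : Type} [CommSemiring R] [CommSemiring S] (F : R →+* S) {m : R} {m' : S}
    (hm : F m = m') (T : FamilyType) (j : ℕ) {x : ℕ → R} {y : ℕ → S}
    (h : ∀ k < 9, F (x k) = y k) : F (famValue m T j x) = famValue m' T j y := by
  rw [famValue, famValue, map_mul, map_form F _ _ h, map_gen F hm _ h]

/-- The `j`-th polynomial of a family. -/
def famPoly (T : FamilyType) (j : ℕ) : CoxRing := famValue (-1) T j coord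

/-- Evaluation at `n` points of `ℂ⁹`. -/
def evalPoints (n : ℕ) (q : ℕ → ℕ → ℕ) : CoxRing →ₗ[ℂ] (Fin n → ℂ) :=
  LinearMap.pi fun i => (aeval fun v => (q i (varIndex v) : ℂ)).toLinearMap

theorem evalPoints_apply (n : ℕ) (q : ℕ → ℕ → ℕ) (f : CoxRing) (i : Fin n) :
    evalPoints n q f i = eval (fun v => (q i (varIndex v) : ℂ)) f := by
  simp [evalPoints, aeval_eq_eval]

/-- The matrix of values at integral points has integer entries, so its determinant can be tested
modulo 1009 with natural number arithmetic. -/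
theorem linearIndependent_evalPoints {n : ℕ} {T : FamilyType} {q : ℕ → ℕ → ℕ}
    (h : elimMatrix n (fun i j => famValue 1008 T j (q i)) = true) :
    LinearIndependent ℂ fun j : Fin n => evalPoints n q (famPoly T j) := by
  set A : Matrix (Fin n) (Fin n) ℤ := fun i j => famValue (-1) T j fun k => (q i k : ℤ) with hA
  have hdet : A.det ≠ 0 := det_ne_zero_of_elimMatrix h A fun i j => by
    have h1 := map_famValue (Int.castRingHom (ZMod 1009)) (m := -1) (m' := -1) (by simp) T j
      (x := fun k => (q i k : ℤ)) (y := fun k => (q i k : ZMod 1009)) (by simp)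
    have h2 := map_famValue (Nat.castRingHom (ZMod 1009)) (m := 1008) (m' := -1) (by rfl) T j
      (x := q i) (y := fun k => (q i k : ZMod 1009)) (by simp)
    exact h1.trans h2.symm
  have hval : ∀ i j : Fin n, evalPoints n q (famPoly T j) i = (A i j : ℂ) := fun i j => by
    rw [evalPoints_apply, famPoly, map_famValue (eval _) (m' := -1) (by simp) T j
      (eval_coord fun k => (q i k : ℂ))]
    exact (map_famValue (Int.castRingHom ℂ) (by simp) T j (by simp)).symm
  have hunit : IsUnit (A.map (Int.castRingHom ℂ)) := by
    rw [Matrix.isUnit_iff_isUnit_det, isUnit_iff_ne_zero]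
    have := RingHom.map_det (Int.castRingHom ℂ) A
    rw [RingHom.mapMatrix_apply] at this
    rw [← this]
    simpa using hdet
  have hcol : (fun j : Fin n => evalPoints n q (famPoly T j)) =
      (A.map (Int.castRingHom ℂ)).col := by
    funext j i
    exact hval i j
  rw [hcol]
  exact Matrix.linearIndependent_cols_of_isUnit hunit

/-- The point `i` of a grid of 125 points in the image of `φ`. -/
def gridPoint (i : ℕ) : ℕ → ℕ := gapPoint (1 + i % 5) (1 + i / 5 % 5) (1 + i / 25)

/-- Products of linear forms. -/
def famForms (d : ℕ × ℕ × ℕ) : FamilyType := fun _ => (d, 6)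

/-- Ten polynomials of multidegree `(1, 1, 2)`, of which the first nine belong to `J₆`. -/
def famTen : FamilyType := fun j =>
  if j < 6 then ((1, 0, 0), j / 2) else if j < 9 then ((0, 1, 0), 3) else ((0, 0, 0), 5)

/-- Polynomials of multidegree `(2, 2, 2)` in `J₆`. -/
def famJ6 : FamilyType := fun j =>
  if j < 27 then ((2, 1, 0), j / 9) else if j < 39 then ((1, 2, 0), 3) else ((1, 0, 2), 4)

/-- The first 50 grid points are those with last gap 1 or 2. Success shows that they impose
independent conditions on forms of this degree. -/
theorem elimMatrix_famForms_one_one_two :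
    elimMatrix 50 (fun i j => famValue 1008 (famForms (1, 1, 2)) j (gridPoint i)) = true := by
  decide +kernel

theorem elimMatrix_famForms_two_two_two :
    elimMatrix 125 (fun i j => famValue 1008 (famForms (2, 2, 2)) j (gridPoint i)) = true := by
  decide +kernel

/-- These polynomials vanish on the image of φ, so grid points cannot separate them; the vectors
`testVec i` are used as points of ℂ⁹ instead. -/
theorem elimMatrix_famTen :
    elimMatrix 10 (fun i j => famValue 1008 famTen j (testVec i)) = true := by
  decide +kernel

theorem elimMatrix_famJ6 :
    elimMatrix 55 (fun i j => famValue 1008 famJ6 j (testVec i)) = true := by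
  decide +kernel

/-! ### Dimensions of multigraded parts -/

/-- The monomials of multidegree `d` span; stars and bars counts them on each factor. -/
theorem exists_finset_weightedHomogeneousSubmodule_le_span (d : Fin 3 → ℕ) :
    ∃ B : Finset CoxRing, B.card ≤ ∏ i : Fin 3, (i.val + 2 + d i - 1).choose (d i) ∧
      weightedHomogeneousSubmodule ℂ multidegree d ≤ Submodule.span ℂ (B : Set CoxRing) := by
  classical
  set P : Finset (∀ i : Fin 3, Fin (i.val + 2) →₀ ℕ) :=
    Fintype.piFinset fun i => Finset.finsuppAntidiag Finset.univ (d i) with hP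
  obtain ⟨F, hF⟩ : ∃ F : (∀ i : Fin 3, Fin (i.val + 2) →₀ ℕ) → CoxRing, ∀ e, F e =
      monomial (Finsupp.equivFunOnFinite.symm fun v => e v.1 v.2) 1 := ⟨_, fun _ => rfl⟩
  refine ⟨P.image F, Finset.card_image_le.trans (le_of_eq ?_), fun f hf => ?_⟩
  · rw [hP, Fintype.card_piFinset]
    refine Finset.prod_congr rfl fun i _ => ?_
    rw [Finset.card_finsuppAntidiag_nat_eq_choose, Finset.card_univ, Fintype.card_fin]
  · rw [f.as_sum]
    refine Submodule.sum_mem _ fun e he => ?_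
    have hd : Finsupp.weight multidegree e = d := hf (mem_support_iff.mp he)
    have h1 : monomial e (coeff e f) = coeff e f • F fun i =>
        Finsupp.equivFunOnFinite.symm fun j => e ⟨i, j⟩ := by
      have he : (Finsupp.equivFunOnFinite.symm fun v : Var => e ⟨v.1, v.2⟩) = e := by
        ext v
        rfl
      rw [hF, smul_monomial, smul_eq_mul, mul_one]
      exact congrArg (fun z => monomial z (coeff e f)) he.symm
    have h2 : (fun i => Finsupp.equivFunOnFinite.symm fun j => e ⟨i, j⟩) ∈ P := by
      rw [hP, Fintype.mem_piFinset]
      intro i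
      have h3 : ∑ j, e ⟨i, j⟩ = d i := by rw [← hd, weight_multidegree_apply]
      rw [Finset.mem_finsuppAntidiag]
      exact ⟨h3, Finset.subset_univ _⟩
    rw [h1]
    exact Submodule.smul_mem _ _ (Submodule.subset_span
      (Finset.mem_coe.mpr (Finset.mem_image_of_mem F h2)))

instance finite_weightedHomogeneousSubmodule (d : Fin 3 → ℕ) :
    Module.Finite ℂ (weightedHomogeneousSubmodule ℂ multidegree d) := by
  obtain ⟨B, -, hB⟩ := exists_finset_weightedHomogeneousSubmodule_le_span d
  exact Submodule.finiteDimensional_of_le hB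

theorem finrank_weightedHomogeneousSubmodule_le (d : Fin 3 → ℕ) :
    Module.finrank ℂ (weightedHomogeneousSubmodule ℂ multidegree d) ≤
      ∏ i : Fin 3, (i.val + 2 + d i - 1).choose (d i) := by
  obtain ⟨B, hcard, hB⟩ := exists_finset_weightedHomogeneousSubmodule_le_span d
  exact ((Submodule.finrank_mono hB).trans (finrank_span_finset_le_card B)).trans hcard

theorem gradedPart_le (I : Ideal CoxRing) (d : Fin 3 → ℕ) :
    gradedPart I d ≤ weightedHomogeneousSubmodule ℂ multidegree d :=
  inf_le_right

instance finite_gradedPart (I : Ideal CoxRing) (d : Fin 3 → ℕ) :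
    Module.Finite ℂ (gradedPart I d) :=
  Submodule.finiteDimensional_of_le (gradedPart_le I d)

theorem gradedPart_mono {I I' : Ideal CoxRing} (h : I ≤ I') (d : Fin 3 → ℕ) :
    gradedPart I d ≤ gradedPart I' d :=
  inf_le_inf_right _ h

theorem le_finrank_of_linearIndependent {n : ℕ} {P : Submodule ℂ CoxRing} [Module.Finite ℂ P]
    {g : Fin n → CoxRing} (hg : LinearIndependent ℂ g) (hP : ∀ j, g j ∈ P) :
    n ≤ Module.finrank ℂ P := by
  have : LinearIndependent ℂ fun j => (⟨g j, hP j⟩ : P) :=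
    LinearIndependent.of_comp P.subtype hg
  simpa using this.fintype_card_le_finrank

/-- Rank–nullity for `φ` on `W`: the kernel contains `P`, and the rank is at least `n`. -/
theorem finrank_add_le_of_linearIndependent {n : ℕ} {P W : Submodule ℂ CoxRing}
    [Module.Finite ℂ W] (hPW : P ≤ W) (φ : CoxRing →ₗ[ℂ] (Fin n → ℂ)) (hφ : ∀ f ∈ P, φ f = 0)
    {g : Fin n → CoxRing} (hgW : ∀ j, g j ∈ W) (hg : LinearIndependent ℂ fun j => φ (g j)) :
    n + Module.finrank ℂ P ≤ Module.finrank ℂ W := by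
  rw [← LinearMap.finrank_range_add_finrank_ker (φ.domRestrict W)]
  refine add_le_add ?_ ?_
  · have : LinearIndependent ℂ fun j =>
        (⟨φ (g j), ⟨g j, hgW j⟩, rfl⟩ : LinearMap.range (φ.domRestrict W)) :=
      LinearIndependent.of_comp (LinearMap.range (φ.domRestrict W)).subtype hg
    simpa using this.fintype_card_le_finrank
  · rw [← (Submodule.comapSubtypeEquivOfLe hPW).finrank_eq]
    exact Submodule.finrank_mono fun f hf => hφ _ hf

/-! ### Membership of the test polynomials -/

theorem isWeightedHomogeneous_linear {ι : Type} [Fintype ι] (v : ι → Var) (i : Fin 3)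
    (hv : ∀ k, (v k).1 = i) (u : ι → ℕ) :
    IsWeightedHomogeneous multidegree (∑ k, (u k : CoxRing) * X (v k)) (Pi.single i 1) := by
  refine IsWeightedHomogeneous.sum _ _ _ fun k _ => ?_
  have := (isWeightedHomogeneous_C multidegree (u k : ℂ)).mul
    (isWeightedHomogeneous_X ℂ multidegree (v k))
  rw [zero_add, multidegree, hv k] at this
  simpa using this

theorem isWeightedHomogeneous_form (d : ℕ × ℕ × ℕ) (u : ℕ → ℕ) :
    IsWeightedHomogeneous multidegree (form d u coord) ![d.1, d.2.1, d.2.2] := by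
  have h0 := isWeightedHomogeneous_linear (fun j : Fin 2 => (⟨0, j⟩ : Var)) 0 (fun _ => rfl)
    fun j => u j
  have h1 := isWeightedHomogeneous_linear (fun j : Fin 3 => (⟨1, j⟩ : Var)) 1 (fun _ => rfl)
    fun j => u (2 + j)
  have h2 := isWeightedHomogeneous_linear (fun j : Fin 4 => (⟨2, j⟩ : Var)) 2 (fun _ => rfl)
    fun j => u (5 + j)
  rw [Fin.sum_univ_two] at h0
  rw [Fin.sum_univ_three] at h1
  rw [Fin.sum_univ_four] at h2
  have h := ((h0.pow d.1).mul (h1.pow d.2.1)).mul (h2.pow d.2.2)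
  have hd : d.1 • (Pi.single 0 1 : Fin 3 → ℕ) + d.2.1 • (Pi.single 1 1 : Fin 3 → ℕ) +
      d.2.2 • (Pi.single 2 1 : Fin 3 → ℕ) = ![d.1, d.2.1, d.2.2] := by
    ext i
    fin_cases i <;> simp
  rw [hd] at h
  exact h

theorem isWeightedHomogeneous_X_mul_X_mul_X (u v w : Var) :
    IsWeightedHomogeneous multidegree (X u * X v * X w : CoxRing)
      (multidegree u + multidegree v + multidegree w) :=
  ((isWeightedHomogeneous_X ℂ multidegree u).mul (isWeightedHomogeneous_X ℂ multidegree v)).mul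
    (isWeightedHomogeneous_X ℂ multidegree w)

/-- The multidegrees of the polynomials `gen`. -/
def genDegree (k : ℕ) : Fin 3 → ℕ :=
  [![0, 1, 2], ![0, 1, 2], ![0, 1, 2], ![1, 0, 2], ![1, 2, 0], ![1, 1, 2]].getD k 0

theorem isWeightedHomogeneous_alternating {p q r s : CoxRing} {d : Fin 3 → ℕ}
    (hp : IsWeightedHomogeneous multidegree p d) (hq : IsWeightedHomogeneous multidegree q d)
    (hr : IsWeightedHomogeneous multidegree r d) (hs : IsWeightedHomogeneous multidegree s d) :
    IsWeightedHomogeneous multidegree (p + -1 * q + r + -1 * s) d := by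
  simp only [neg_one_mul]
  exact ((hp.add hq.neg).add hr).add hs.neg

theorem isWeightedHomogeneous_gen (k : ℕ) :
    IsWeightedHomogeneous multidegree (gen (-1) k coord) (genDegree k) := by
  have bcc : ∀ i j k, IsWeightedHomogeneous multidegree (b i * c j * c k) ![0, 1, 2] :=
    fun i j k => by
      have := isWeightedHomogeneous_X_mul_X_mul_X ⟨1, i⟩ ⟨2, j⟩ ⟨2, k⟩
      rwa [show multidegree ⟨1, i⟩ + multidegree ⟨2, j⟩ + multidegree ⟨2, k⟩ = ![0, 1, 2] by
        ext l; fin_cases l <;> simp [multidegree]] at this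
  have acc : ∀ i j k, IsWeightedHomogeneous multidegree (a i * c j * c k) ![1, 0, 2] :=
    fun i j k => by
      have := isWeightedHomogeneous_X_mul_X_mul_X ⟨0, i⟩ ⟨2, j⟩ ⟨2, k⟩
      rwa [show multidegree ⟨0, i⟩ + multidegree ⟨2, j⟩ + multidegree ⟨2, k⟩ = ![1, 0, 2] by
        ext l; fin_cases l <;> simp [multidegree]] at this
  have abb : ∀ i j k, IsWeightedHomogeneous multidegree (a i * b j * b k) ![1, 2, 0] :=
    fun i j k => by
      have := isWeightedHomogeneous_X_mul_X_mul_X ⟨0, i⟩ ⟨1, j⟩ ⟨1, k⟩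
      rwa [show multidegree ⟨0, i⟩ + multidegree ⟨1, j⟩ + multidegree ⟨1, k⟩ = ![1, 2, 0] by
        ext l; fin_cases l <;> simp [multidegree]] at this
  have abcc : ∀ i j k l, IsWeightedHomogeneous multidegree (a i * b j * c k * c l) ![1, 1, 2] :=
    fun i j k l => by
      have := (isWeightedHomogeneous_X_mul_X_mul_X ⟨0, i⟩ ⟨1, j⟩ ⟨2, k⟩).mul
        (isWeightedHomogeneous_X ℂ multidegree ⟨2, l⟩)
      rwa [show multidegree ⟨0, i⟩ + multidegree ⟨1, j⟩ + multidegree ⟨2, k⟩ +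
        multidegree ⟨2, l⟩ = ![1, 1, 2] by ext l; fin_cases l <;> simp [multidegree]] at this
  match k with
  | 0 => exact isWeightedHomogeneous_alternating (bcc 1 1 2) (bcc 2 1 2) (bcc 2 1 3) (bcc 1 2 3)
  | 1 => exact isWeightedHomogeneous_alternating (bcc 0 0 2) (bcc 2 0 2) (bcc 2 0 3) (bcc 0 2 3)
  | 2 => exact isWeightedHomogeneous_alternating (bcc 0 0 1) (bcc 1 0 1) (bcc 1 0 3) (bcc 0 1 3)
  | 3 => exact isWeightedHomogeneous_alternating (acc 0 0 1) (acc 1 0 1) (acc 1 0 2) (acc 0 1 2)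
  | 4 => exact isWeightedHomogeneous_alternating (abb 0 0 1) (abb 1 0 1) (abb 1 0 2) (abb 0 1 2)
  | 5 =>
    -- The six terms are grouped to fit the pattern of four alternating summands.
    have := isWeightedHomogeneous_alternating
      ((abcc 0 1 0 3).add (abcc 1 2 0 3)) (abcc 1 2 0 2)
      (((abcc 1 1 0 3).neg).add (abcc 1 1 0 2)) (abcc 0 1 2 3)
    convert this using 1
    simp only [gen, coord, List.getD_cons_zero, List.getD_cons_succ]
    ring
    rfl
  | k + 6 => exact isWeightedHomogeneous_one ℂ multidegree

theorem span_range_gen : Ideal.span (Set.range fun k : Fin 5 => gen (-1) k coord) = J6 := by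
  rw [J6]
  congr 1
  have h : (fun k : Fin 5 => gen (-1) k coord) =
    ![b 1 * c 1 * c 2 - b 2 * c 1 * c 2 + b 2 * c 1 * c 3 - b 1 * c 2 * c 3,
      b 0 * c 0 * c 2 - b 2 * c 0 * c 2 + b 2 * c 0 * c 3 - b 0 * c 2 * c 3,
      b 0 * c 0 * c 1 - b 1 * c 0 * c 1 + b 1 * c 0 * c 3 - b 0 * c 1 * c 3,
      a 0 * c 0 * c 1 - a 1 * c 0 * c 1 + a 1 * c 0 * c 2 - a 0 * c 1 * c 2,
      a 0 * b 0 * b 1 - a 1 * b 0 * b 1 + a 1 * b 0 * b 2 - a 0 * b 1 * b 2] := by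
    funext k
    fin_cases k <;> simp [gen, coord, sub_eq_add_neg]
  rw [h]
  simp only [Matrix.range_cons, Matrix.range_empty, Set.singleton_union, insert_empty_eq]

theorem gen_mem_J6 {k : ℕ} (hk : k < 5) : gen (-1) k coord ∈ J6 := by
  rw [← span_range_gen]
  exact Ideal.subset_span ⟨⟨k, hk⟩, rfl⟩

/-- After clearing denominators, vanishing on φ(M_{0,6}) is a polynomial identity in the coordinates
of six vectors of ℂ². -/
theorem gen_mem_idealMBar06 {k : ℕ} (hk : k < 6) : gen (-1) k coord ∈ idealMBar06 := by
  refine mem_idealMBar06_of_vanishesAt (isWeightedHomogeneous_gen k) (forall_range_phi.mpr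
    fun p => (vanishesAt_phiConfig_iff (isWeightedHomogeneous_gen k) p).mpr ?_)
  set v := fun k => (p.1 k).rep with hv
  have hne : ∀ k l, k ≠ l → bracket (v k) (v l) ≠ 0 := fun k l h =>
    bracket_rep_ne_zero (p.2.ne h)
  rw [map_gen (eval _) (m' := -1) (by simp) k (fun _ _ => rfl)]
  have h31 := hne 3 1 (by decide)
  have h32 := hne 3 2 (by decide)
  have h41 := hne 4 1 (by decide)
  have h42 := hne 4 2 (by decide)
  have h43 := hne 4 3 (by decide)
  have h51 := hne 5 1 (by decide)
  have h52 := hne 5 2 (by decide)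
  have h53 := hne 5 3 (by decide)
  have h54 := hne 5 4 (by decide)
  interval_cases k <;> simp [gen, coord, a, b, c, phiCoord] <;> field_simp <;>
    simp only [bracket] <;> ring

/-! ### The multigraded parts of the two ideals -/

theorem J6_le_idealMBar06 : J6 ≤ idealMBar06 := by
  rw [← span_range_gen]
  exact Ideal.span_le.mpr (Set.range_subset_iff.mpr fun k => gen_mem_idealMBar06 (by omega))

theorem famPoly_mem_gradedPart {I : Ideal CoxRing} {T : FamilyType} {j : ℕ} {d : Fin 3 → ℕ}
    (hI : gen (-1) (T j).2 coord ∈ I)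
    (hd : ![(T j).1.1, (T j).1.2.1, (T j).1.2.2] + genDegree (T j).2 = d) :
    famPoly T j ∈ gradedPart I d := by
  refine ⟨I.mul_mem_left _ hI, ?_⟩
  rw [← hd]
  exact (isWeightedHomogeneous_form _ _).mul (isWeightedHomogeneous_gen _)

theorem add_finrank_gradedPart_idealMBar06_le {n : ℕ} {d : ℕ × ℕ × ℕ}
    (h : elimMatrix n (fun i j => famValue 1008 (famForms d) j (gridPoint i)) = true) :
    n + Module.finrank ℂ (gradedPart idealMBar06 ![d.1, d.2.1, d.2.2]) ≤
      ∏ i : Fin 3, (i.val + 2 + ![d.1, d.2.1, d.2.2] i - 1).choose (![d.1, d.2.1, d.2.2] i) := by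
  refine (finrank_add_le_of_linearIndependent (gradedPart_le _ _) (evalPoints n gridPoint)
    (fun f hf => ?_) (fun j => ?_) (linearIndependent_evalPoints h)).trans
    (finrank_weightedHomogeneousSubmodule_le _)
  · ext i
    rw [evalPoints_apply]
    exact eval_gapPoint_eq_zero hf.2 hf.1 (by omega) (by omega) (by omega)
  -- Pure products of linear forms have the factor `gen` equal to 1, whose `genDegree` is the
  -- default value 0.
  · exact gradedPart_le ⊤ _ (famPoly_mem_gradedPart Submodule.mem_top (add_zero _))

theorem finrank_gradedPart_idealMBar06_one_one_two_le :
    Module.finrank ℂ (gradedPart idealMBar06 ![1, 1, 2]) ≤ 10 := by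
  -- There are 2 · 3 · 10 = 60 monomials of this multidegree.
  exact Nat.le_of_add_le_add_left (a := 50)
    ((add_finrank_gradedPart_idealMBar06_le elimMatrix_famForms_one_one_two).trans_eq
      (by decide +kernel))

theorem finrank_gradedPart_idealMBar06_two_two_two_le :
    Module.finrank ℂ (gradedPart idealMBar06 ![2, 2, 2]) ≤ 55 := by
  -- There are 3 · 6 · 10 = 180 monomials of this multidegree.
  exact Nat.le_of_add_le_add_left (a := 125)
    ((add_finrank_gradedPart_idealMBar06_le elimMatrix_famForms_two_two_two).trans_eq
      (by decide +kernel))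

/-- The 55 elements are nine multiples of each of f₁, f₂, f₃, twelve of f₄ and sixteen of f₅. The
space of multipliers of f₅ has dimension 20, but sixteen suffice. -/
theorem le_finrank_gradedPart_J6_two_two_two :
    55 ≤ Module.finrank ℂ (gradedPart J6 ![2, 2, 2]) := by
  refine le_finrank_of_linearIndependent
    (LinearIndependent.of_comp _ (linearIndependent_evalPoints elimMatrix_famJ6)) fun j => ?_
  have key : ∀ j < 55, (famJ6 j).2 < 5 ∧
      ![(famJ6 j).1.1, (famJ6 j).1.2.1, (famJ6 j).1.2.2] + genDegree (famJ6 j).2 = ![2, 2, 2] := by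
    decide +kernel
  exact famPoly_mem_gradedPart (gen_mem_J6 (key j j.2).1) (key j j.2).2

theorem linearIndependent_famTen : LinearIndependent ℂ fun j : Fin 10 => famPoly famTen j :=
  LinearIndependent.of_comp _ (linearIndependent_evalPoints elimMatrix_famTen)

theorem famTen_degree : ∀ j < 10, (famTen j).2 < 6 ∧
    ![(famTen j).1.1, (famTen j).1.2.1, (famTen j).1.2.2] + genDegree (famTen j).2 =
      ![1, 1, 2] := by
  decide +kernel

theorem le_finrank_gradedPart_idealMBar06_one_one_two :
    10 ≤ Module.finrank ℂ (gradedPart idealMBar06 ![1, 1, 2]) :=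
  le_finrank_of_linearIndependent linearIndependent_famTen fun j =>
    famPoly_mem_gradedPart (gen_mem_idealMBar06 (famTen_degree j j.2).1) (famTen_degree j j.2).2

theorem le_finrank_gradedPart_J6_one_one_two :
    9 ≤ Module.finrank ℂ (gradedPart J6 ![1, 1, 2]) := by
  refine le_finrank_of_linearIndependent
    (linearIndependent_famTen.comp (Fin.castSucc : Fin 9 → Fin 10)
      (Fin.castSucc_injective 9)) fun j => ?_
  have key : ∀ j < 9, (famTen j).2 < 5 := by decide +kernel
  exact famPoly_mem_gradedPart (gen_mem_J6 (key j j.2)) (famTen_degree j (by omega)).2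

/-- An element of this degree is a combination of f₁, f₂, f₃ with multipliers linear in the `a i`
and of f₄ with a multiplier linear in the `b i`. -/
theorem finrank_gradedPart_J6_one_one_two_le :
    Module.finrank ℂ (gradedPart J6 ![1, 1, 2]) ≤ 9 := by
  let W (d : Fin 3 → ℕ) := weightedHomogeneousSubmodule ℂ multidegree d
  let δ : Fin 4 → Fin 3 → ℕ := fun k => ![1, 1, 2] - genDegree k
  let Ψ : (∀ k : Fin 4, W (δ k)) →ₗ[ℂ] CoxRing :=
    LinearMap.lsum ℂ (fun k => W (δ k)) ℂ fun k =>
      LinearMap.mulLeft ℂ (gen (-1) k coord) ∘ₗ (W (δ k)).subtype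
  have hΨ : ∀ x, Ψ x = ∑ k : Fin 4, gen (-1) k coord * (x k : CoxRing) := fun x => by
    simp [Ψ, LinearMap.lsum_apply]
  have hle : gradedPart J6 ![1, 1, 2] ≤ LinearMap.range Ψ := by
    intro f ⟨hfJ, hf⟩
    have hfJ' : f ∈ J6 := hfJ
    rw [← span_range_gen, Ideal.mem_span_range_iff_exists_fun] at hfJ'
    obtain ⟨h, rfl⟩ := hfJ'
    rw [← IsWeightedHomogeneous.weightedHomogeneousComponent_same hf]
    refine ⟨fun k => ⟨weightedHomogeneousComponent multidegree (δ k) (h k.castSucc),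
      weightedHomogeneousComponent_mem _ _ _⟩, ?_⟩
    have h1 : ∀ k : Fin 4, ∀ i, genDegree k i ≤ ![1, 1, 2] i := by decide +kernel
    have h2 : ¬ ∀ i, genDegree 4 i ≤ ![1, 1, 2] i := by decide +kernel
    -- f₅ has multidegree (1,2,0), so none of its multiples has a component of multidegree (1,1,2).
    have h3 : weightedHomogeneousComponent multidegree ![1, 1, 2]
        (gen (-1) (Fin.last 4 : ℕ) coord * h (Fin.last 4)) = 0 := by
      rw [weightedHomogeneousComponent_mul (isWeightedHomogeneous_gen _)]
      exact if_neg h2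
    simp only [Fin.sum_univ_castSucc (n := 4), map_add, map_sum, mul_comm (h _), h3, add_zero]
    rw [hΨ]
    refine Finset.sum_congr rfl fun k _ => ?_
    rw [weightedHomogeneousComponent_mul (isWeightedHomogeneous_gen _)]
    exact (if_pos (h1 k)).symm
  have hdim : ∀ k : Fin 4, ∏ i : Fin 3, (i.val + 2 + δ k i - 1).choose (δ k i) = ![2, 2, 2, 3] k := by
    decide +kernel
  calc Module.finrank ℂ (gradedPart J6 ![1, 1, 2])
      ≤ Module.finrank ℂ (LinearMap.range Ψ) := Submodule.finrank_mono hle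
    _ ≤ Module.finrank ℂ (∀ k : Fin 4, W (δ k)) := LinearMap.finrank_range_le Ψ
    _ = ∑ k : Fin 4, Module.finrank ℂ (W (δ k)) := Module.finrank_pi_fintype ℂ
    _ ≤ ∑ k : Fin 4, ![2, 2, 2, 3] k := Finset.sum_le_sum fun k _ =>
        (finrank_weightedHomogeneousSubmodule_le (δ k)).trans_eq (hdim k)
    _ = 9 := by decide

end MBar06

end

theorem mainTheorem10 :
    (∃! I6 : Ideal MBar06.CoxRing, MBar06.IsSaturatedIdealOf I6 MBar06.imageMBar06) ∧
    ∀ I6 : Ideal MBar06.CoxRing, MBar06.IsSaturatedIdealOf I6 MBar06.imageMBar06 →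
      MBar06.J6 < I6 ∧
      Module.finrank ℂ (MBar06.gradedPart MBar06.J6 ![1, 1, 2]) = 9 ∧
      Module.finrank ℂ (MBar06.gradedPart I6 ![1, 1, 2]) = 10 ∧
      MBar06.gradedPart MBar06.J6 ![2, 2, 2] = MBar06.gradedPart I6 ![2, 2, 2] ∧
      Module.finrank ℂ (MBar06.gradedPart MBar06.J6 ![2, 2, 2]) = 55 ∧
      Module.finrank ℂ (MBar06.gradedPart I6 ![2, 2, 2]) = 55 := by
  refine ⟨⟨_, MBar06.isSaturatedIdealOf_idealMBar06,
    fun I hI => hI.unique MBar06.isSaturatedIdealOf_idealMBar06⟩, fun I hI => ?_⟩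
  obtain rfl := hI.unique MBar06.isSaturatedIdealOf_idealMBar06
  have hJ1 := le_antisymm MBar06.finrank_gradedPart_J6_one_one_two_le
    MBar06.le_finrank_gradedPart_J6_one_one_two
  have hI1 := le_antisymm MBar06.finrank_gradedPart_idealMBar06_one_one_two_le
    MBar06.le_finrank_gradedPart_idealMBar06_one_one_two
  have heq := Submodule.eq_of_le_of_finrank_le
    (MBar06.gradedPart_mono MBar06.J6_le_idealMBar06 ![2, 2, 2])
    (MBar06.finrank_gradedPart_idealMBar06_two_two_two_le.trans
      MBar06.le_finrank_gradedPart_J6_two_two_two)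
  have hI2 := le_antisymm MBar06.finrank_gradedPart_idealMBar06_two_two_two_le
    (heq ▸ MBar06.le_finrank_gradedPart_J6_two_two_two)
  refine ⟨lt_of_le_of_ne MBar06.J6_le_idealMBar06 fun h => ?_, hJ1, hI1, heq, ?_, hI2⟩
  · rw [h, hI1] at hJ1
    norm_num at hJ1
  · rw [heq, hI2]
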